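/- Let $n,k\ge 1$ be integers and let $\mathcal P(n,k)$ be the $k$-nearest neighbor platoon: the graph with vertices $1,\dots,n$ in which distinct $i,j$ are adjacent if and only if $|i-j|\le k$. Let $\mathcal R\subseteq\{1,\dots,n\}$ be a nonempty set of reference vehicles and $\mathcal F$ its complement (the followers), and let $\mathcal L_g$ be the grounded Laplacian, i.e. the matrix obtained from the graph Laplacian of $\mathcal P(n,k)$ by deleting the rows and columns indexed by $\mathcal R$. Put $$\mathcal B=I_{|\mathcal F|}\otimes\begin{bmatrix}0&1\\0&0\end{bmatrix}+\mathcal L_g\otimes\begin{bmatrix}0&0\\-1&-1\end{bmatrix}.$$ If $\tau_{\max}<\frac1{4k}$, then for every constant delay $\tau\in[0,\tau_{\max}]$ the delayed network formation dynamics $$\dot x(t)=\mathcal B\,x(t-\tau),\qquad t\ge 0,$$ with continuous initial history on $[-\tau,0]$, is asymptotically stable: for every $\varepsilon>0$ there is $\delta>0$ such that every solution with $\sup_{\theta\in[-\tau,0]}\|x(\theta)\|<\delta$ satisfies $\|x(t)\|<\varepsilon$ for all $t\ge0$, and every solution satisfies $x(t)\to0$ as $t\to\infty$. -/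

import Mathlib

open scoped Kronecker

/-- The `k`-nearest neighbor platoon `P(n,k)`: vehicles `0, …, n-1` on a line, two distinct
vehicles being adjacent iff their positions in the line differ by at most `k`. -/
def platoon (n k : ℕ) : SimpleGraph (Fin n) where
  Adj i j := i ≠ j ∧ |((i : ℕ) : ℤ) - ((j : ℕ) : ℤ)| ≤ (k : ℤ)
  symm := ⟨fun _ _ h => ⟨h.1.symm, by rw [abs_sub_comm]; exact h.2⟩⟩
  loopless := ⟨fun _ h => h.1 rfl⟩

instance platoonDecidableAdj (n k : ℕ) : DecidableRel (platoon n k).Adj := fun i j =>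
  inferInstanceAs (Decidable (i ≠ j ∧ |((i : ℕ) : ℤ) - ((j : ℕ) : ℤ)| ≤ (k : ℤ)))

/-- The grounded Laplacian: the graph Laplacian with the rows and columns of the grounded nodes
`R` (the reference vehicles) removed. It is indexed by the followers. -/
def groundedLaplacian {V : Type*} [Fintype V] [DecidableEq V] (G : SimpleGraph V)
    [DecidableRel G.Adj] (R : Finset V) : Matrix {v : V // v ∉ R} {v : V // v ∉ R} ℝ :=
  (G.lapMatrix ℝ).submatrix Subtype.val Subtype.val

/-- The matrix `I ⊗ B₁ + L_g ⊗ B₂` of the network formation dynamics with control gains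
`kp`, `ku`. The coordinate `(i, 0)` is the position error of follower `i`, the coordinate `(i, 1)`
its velocity error. -/
def formationMatrix {V : Type*} [Fintype V] [DecidableEq V] (G : SimpleGraph V)
    [DecidableRel G.Adj] (R : Finset V) (kp ku : ℝ) :
    Matrix ({v : V // v ∉ R} × Fin 2) ({v : V // v ∉ R} × Fin 2) ℝ :=
  (1 : Matrix {v : V // v ∉ R} {v : V // v ∉ R} ℝ) ⊗ₖ !![0, 1; 0, 0]
    + groundedLaplacian G R ⊗ₖ !![0, 0; -kp, -ku]

/-- `x` solves `x'(t) = A x(t - τ)` for `t ≥ 0`, with a continuous initial history on `[-τ, 0]`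
(the derivative is one-sided at `t = 0` and two-sided for `t > 0`). -/
structure IsDelaySolution {ι : Type*} [Fintype ι] (A : Matrix ι ι ℝ) (τ : ℝ)
    (x : ℝ → ι → ℝ) : Prop where
  continuousOn : ContinuousOn x (Set.Ici (-τ))
  hasDeriv : ∀ t : ℝ, 0 ≤ t → HasDerivWithinAt x (A.mulVec (x (t - τ))) (Set.Ici 0) t

/-- Asymptotic stability of `x'(t) = A x(t - τ)`: the zero solution is Lyapunov stable with respect
to the sup norm of the initial history, and every solution tends to zero. -/
structure DelayAsymptoticallyStable {ι : Type*} [Fintype ι] (A : Matrix ι ι ℝ) (τ : ℝ) :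
    Prop where
  stable : ∀ ε : ℝ, 0 < ε → ∃ δ : ℝ, 0 < δ ∧ ∀ x : ℝ → ι → ℝ, IsDelaySolution A τ x →
    (∀ θ ∈ Set.Icc (-τ) 0, ‖x θ‖ < δ) → ∀ t : ℝ, 0 ≤ t → ‖x t‖ < ε
  attractive : ∀ x : ℝ → ι → ℝ, IsDelaySolution A τ x →
    Filter.Tendsto x Filter.atTop (nhds 0)

/-! The delay equation is reduced to an algebraic inequality. Suppose a positive semidefinite form
`B` satisfies `2 B(u, Au) + 2τ B(Au, Au) < 0` for `u ≠ 0`. Since `x(t+τ)` differs from `x(t)` by the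
integral of `A x(s)` over `[t-τ, t]`, completing the square bounds the derivative of `B(x(t+τ),
x(t+τ))`, and a double integral over the delay window absorbs the history terms. This bounds the
integral of `‖x‖²` by the squared size of the history (`delay_integral_norm_sq_le`), which gives
both Lyapunov stability and convergence (`delayAsymptoticallyStable_of_bilinear`).

For the formation dynamics, `energyForm` in the variables position + τ · velocity and velocity is
such a `B` whenever `L` is symmetric positive definite, `τ L < 1` and `τ < 1/2`
(`kronecker_formation_stable`). A nonempty reference set in a connected graph makes the grounded
Laplacian positive definite; degrees at most `2k` bound it by `4k`, so `τ < 1/(4k)` suffices. -/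

/-! ### Lyapunov–Krasovskii estimates for linear delay equations -/

open MeasureTheory Set Filter Topology in
/-- Dissipation inequality for the delay equation with generator `a` along a Lyapunov–Krasovskii functional. -/
theorem delay_integral_norm_sq_le {E : Type*} [NormedAddCommGroup E] [NormedSpace ℝ E]
    (a : E →L[ℝ] E) (B : E →L[ℝ] E →L[ℝ] ℝ) (hsymm : ∀ u v, B u v = B v u)
    (hnonneg : ∀ u, 0 ≤ B u u) {τ c : ℝ} (hτ : 0 ≤ τ)
    (hB : ∀ u, 2 * B u (a u) + 2 * τ * B (a u) (a u) ≤ -c * ‖u‖ ^ 2)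
    {x : ℝ → E} (hx : Continuous x) (hderiv : ∀ t, 0 < t → HasDerivAt x (a (x (t - τ))) t)
    {T : ℝ} (hT : 0 ≤ T) :
    c * ∫ s in (0 : ℝ)..T, ‖x s‖ ^ 2 ≤
      B (x τ) (x τ) + τ * ∫ s in (-τ)..0, B (a (x s)) (a (x s)) := by
  set h : ℝ → ℝ := fun s => B (a (x s)) (a (x s)) with hh
  have hhc : Continuous h := by fun_prop
  have hh0 : ∀ s, 0 ≤ h s := fun s => hnonneg _
  set H : ℝ → ℝ := fun t => ∫ s in (-τ)..t, h s with hHdef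
  have hH : ∀ t, HasDerivAt H (h t) t := fun t =>
    intervalIntegral.integral_hasDerivAt_right (hhc.intervalIntegrable _ _)
      (hhc.stronglyMeasurableAtFilter _ _) hhc.continuousAt
  have hHc : Continuous H := continuous_iff_continuousAt.2 fun t => (hH t).continuousAt
  have hHmono : Monotone H :=
    monotone_of_deriv_nonneg (fun t => (hH t).differentiableAt) fun t => by
      rw [(hH t).deriv]; exact hh0 t
  have hH0 : H (-τ) = 0 := by simp [hHdef]
  set K : ℝ → ℝ := fun t => ∫ s in (-τ)..t, H s with hKdef
  have hK : ∀ t, HasDerivAt K (H t) t := fun t =>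
    intervalIntegral.integral_hasDerivAt_right (hHc.intervalIntegrable _ _)
      (hHc.stronglyMeasurableAtFilter _ _) hHc.continuousAt
  have hKsub : ∀ t, K t - K (t - τ) ≤ τ * H t := by
    intro t
    have : K t - K (t - τ) = ∫ s in (t - τ)..t, H s :=
      intervalIntegral.integral_interval_sub_left (hHc.intervalIntegrable _ _)
        (hHc.intervalIntegrable _ _)
    rw [this]
    calc ∫ s in (t - τ)..t, H s ≤ ∫ s in (t - τ)..t, H t :=
          intervalIntegral.integral_mono_on (by linarith) (hHc.intervalIntegrable _ _)
            (continuous_const.intervalIntegrable _ _) fun s hs => hHmono hs.2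
      _ = τ * H t := by simp
  have hK0 : 0 ≤ K 0 - K (0 - τ) := by
    have h1 : K (0 - τ) = 0 := by simp [hKdef]
    rw [h1, sub_zero]
    exact intervalIntegral.integral_nonneg (by linarith) fun s hs => by
      rw [← hH0]; exact hHmono hs.1
  have hmix : ∀ t, 0 ≤ t → 2 * B (x (t + τ)) (a (x t)) ≤
      2 * B (x t) (a (x t)) + τ * h t + (H t - H (t - τ)) := by
    intro t ht
    set w := a (x t) with hw
    -- With `w` frozen, `B(z - w, z - w) ≥ 0` for `z = a (x (s - τ))` makes this function
    -- nonincreasing; comparing `s = t` with `s = t + τ` gives the claim.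
    have hder : ∀ s, 0 < s → HasDerivAt (fun s => 2 * B (x s) w - H (s - τ) - s * B w w)
        (2 * B (a (x (s - τ))) w - h (s - τ) - 1 * B w w) s := by
      intro s hs
      have h1 : HasDerivAt (fun s => B (x s) w) (B (a (x (s - τ))) w) s :=
        ((B.flip w).hasFDerivAt.comp_hasDerivAt s (hderiv s hs))
      have h2 : HasDerivAt (fun s => H (s - τ)) (h (s - τ)) s := by
        simpa using (hH (s - τ)).comp_sub_const s τ
      exact ((h1.const_mul 2).sub h2).sub ((hasDerivAt_id s).mul_const _)
    have hanti : AntitoneOn (fun s => 2 * B (x s) w - H (s - τ) - s * B w w) (Ici 0) := by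
      apply antitoneOn_of_deriv_nonpos (convex_Ici 0)
      · exact Continuous.continuousOn (by fun_prop)
      · intro s hs
        rw [interior_Ici] at hs
        exact (hder s hs).differentiableAt.differentiableWithinAt
      · intro s hs
        rw [interior_Ici] at hs
        rw [(hder s hs).deriv]
        have h1 := hnonneg (a (x (s - τ)) - w)
        simp only [map_sub, sub_apply] at h1
        rw [hsymm w (a (x (s - τ)))] at h1
        simp only [hh]
        linarith
    have := hanti (mem_Ici.2 ht) (mem_Ici.2 (by linarith : (0 : ℝ) ≤ t + τ)) (by linarith)
    simp only [add_sub_cancel_right] at this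
    have h3 : h t = B w w := rfl
    rw [h3]
    linarith
  have hN : Continuous fun s => ‖x s‖ ^ 2 := by fun_prop
  set J : ℝ → ℝ := fun t => ∫ s in (0 : ℝ)..t, ‖x s‖ ^ 2 with hJdef
  have hJ : ∀ t, HasDerivAt J (‖x t‖ ^ 2) t := fun t =>
    intervalIntegral.integral_hasDerivAt_right (hN.intervalIntegrable _ _)
      (hN.stronglyMeasurableAtFilter _ _) hN.continuousAt
  have hJc : Continuous J := continuous_iff_continuousAt.2 fun t => (hJ t).continuousAt
  have hKc : Continuous K := continuous_iff_continuousAt.2 fun t => (hK t).continuousAt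
  -- `τ H t - (K t - K (t - τ))` is the integral of `H t - H s` over `s ∈ [t-τ, t]`. It is
  -- nonnegative, and its derivative cancels the increment of `H` in `hmix`.
  set W : ℝ → ℝ := fun t =>
    B (x (t + τ)) (x (t + τ)) + c * J t + τ * H t - (K t - K (t - τ)) with hWdef
  have hW : ∀ t, 0 < t → HasDerivAt W
      (B (x (t + τ)) (a (x t)) + B (a (x t)) (x (t + τ)) + c * ‖x t‖ ^ 2 + τ * h t
        - (H t - H (t - τ))) t := by
    intro t ht
    have h1 : HasDerivAt (fun t => x (t + τ)) (a (x t)) t := by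
      have := (hderiv (t + τ) (by linarith)).comp_add_const t τ
      simpa using this
    have h2 := B.hasFDerivAt_of_bilinear h1.hasFDerivAt h1.hasFDerivAt
    have h3 : HasDerivAt (fun t => B (x (t + τ)) (x (t + τ)))
        (B (x (t + τ)) (a (x t)) + B (a (x t)) (x (t + τ))) t := by
      simpa using h2.hasDerivAt
    have h4 : HasDerivAt (fun t => K (t - τ)) (H (t - τ)) t := (hK (t - τ)).comp_sub_const t τ
    exact ((h3.add ((hJ t).const_mul c)).add ((hH t).const_mul τ)).sub ((hK t).sub h4)
  have hWanti : AntitoneOn W (Ici 0) := by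
    apply antitoneOn_of_deriv_nonpos (convex_Ici 0)
    · exact Continuous.continuousOn (by fun_prop)
    · intro s hs
      rw [interior_Ici] at hs
      exact (hW s hs).differentiableAt.differentiableWithinAt
    · intro s hs
      rw [interior_Ici] at hs
      rw [(hW s hs).deriv, hsymm (a (x s))]
      have h1 := hmix s (le_of_lt hs)
      have h2 := hB (x s)
      have h3 : h s = B (a (x s)) (a (x s)) := rfl
      rw [← h3] at h2
      linarith
  have hfin := hWanti (mem_Ici.2 le_rfl) (mem_Ici.2 hT) hT
  have hJ0 : J 0 = 0 := by simp [hJdef]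
  simp only [hWdef, zero_add, hJ0, mul_zero, add_zero] at hfin
  have h1 := hKsub T
  have h2 := hnonneg (x (T + τ))
  linarith

/-- The value at time `τ` is controlled by the initial history. -/
theorem delay_norm_le_of_history {E : Type*} [NormedAddCommGroup E] [NormedSpace ℝ E]
    (a : E →L[ℝ] E) {τ δ : ℝ} (hτ : 0 ≤ τ)
    {x : ℝ → E} (hx : Continuous x) (hderiv : ∀ t, 0 < t → HasDerivAt x (a (x (t - τ))) t)
    (hδ : ∀ θ ∈ Set.Icc (-τ) 0, ‖x θ‖ ≤ δ) : ‖x τ‖ ≤ (1 + ‖a‖ * τ) * δ := by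
  have hder : ∀ t ∈ Set.Ico (0 : ℝ) τ, HasDerivWithinAt x (a (x (t - τ))) (Set.Ici t) t := by
    intro t ht
    rcases ht.1.eq_or_lt with rfl | h
    -- The equation is assumed only for `t > 0`, so the right derivative at `0` comes from the limit
    -- of the derivatives.
    · refine hasDerivWithinAt_Ici_of_tendsto_deriv (s := Set.Ioi 0)
        (fun s hs => (hderiv s hs).differentiableAt.differentiableWithinAt)
        hx.continuousWithinAt self_mem_nhdsWithin ?_
      have : Filter.Tendsto (fun s => a (x (s - τ))) (nhdsWithin 0 (Set.Ioi 0))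
          (nhds (a (x (0 - τ)))) :=
        (Continuous.tendsto (by fun_prop) 0).mono_left nhdsWithin_le_nhds
      refine this.congr' ?_
      filter_upwards [self_mem_nhdsWithin] with s hs
      exact (hderiv s hs).deriv.symm
    · exact (hderiv t h).hasDerivWithinAt
  have h1 := norm_image_sub_le_of_norm_deriv_right_le_segment (C := ‖a‖ * δ) hx.continuousOn hder
    (fun t ht => (a.le_opNorm _).trans (mul_le_mul_of_nonneg_left
      (hδ _ ⟨by linarith [ht.1], by linarith [ht.2]⟩) (norm_nonneg _))) τ ⟨hτ, le_rfl⟩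
  have h2 := hδ 0 ⟨by linarith, le_rfl⟩
  have h3 := norm_le_norm_add_norm_sub' (x τ) (x 0)
  nlinarith

/-- Each coordinate of a solution is controlled by integrals of the squared norm. -/
theorem delay_coord_sq_le {ι : Type*} [Fintype ι] (a : (ι → ℝ) →L[ℝ] (ι → ℝ)) {τ : ℝ}
    {x : ℝ → ι → ℝ} (hx : Continuous x)
    (hderiv : ∀ t, 0 < t → HasDerivAt x (a (x (t - τ))) t) (i : ι) {t : ℝ} (ht : 0 ≤ t) :
    x t i ^ 2 ≤ x 0 i ^ 2 + (∫ s in (0 : ℝ)..t, ‖x s‖ ^ 2)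
      + ‖a‖ ^ 2 * ∫ s in (0 : ℝ)..t, ‖x (s - τ)‖ ^ 2 := by
  have hN : Continuous fun s => ‖x s‖ ^ 2 := by fun_prop
  have hM : Continuous fun s => ‖x (s - τ)‖ ^ 2 := by fun_prop
  have hJ : ∀ t, HasDerivAt (fun t => ∫ s in (0 : ℝ)..t, ‖x s‖ ^ 2) (‖x t‖ ^ 2) t := fun t =>
    intervalIntegral.integral_hasDerivAt_right (hN.intervalIntegrable _ _)
      (hN.stronglyMeasurableAtFilter _ _) hN.continuousAt
  have hJ' : ∀ t, HasDerivAt (fun t => ∫ s in (0 : ℝ)..t, ‖x (s - τ)‖ ^ 2)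
      (‖x (t - τ)‖ ^ 2) t := fun t =>
    intervalIntegral.integral_hasDerivAt_right (hM.intervalIntegrable _ _)
      (hM.stronglyMeasurableAtFilter _ _) hM.continuousAt
  have hi : ∀ t, 0 < t → HasDerivAt (fun t => x t i) (a (x (t - τ)) i) t := fun t ht =>
    hasDerivAt_pi.1 (hderiv t ht) i
  have hxi : Continuous fun t => x t i := by fun_prop
  have hJc := continuous_iff_continuousAt.2 fun t => (hJ t).continuousAt
  have hJc' := continuous_iff_continuousAt.2 fun t => (hJ' t).continuousAt
  have hW : ∀ t, 0 < t → HasDerivAt (fun t => x t i ^ 2 - (∫ s in (0 : ℝ)..t, ‖x s‖ ^ 2)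
      - ‖a‖ ^ 2 * ∫ s in (0 : ℝ)..t, ‖x (s - τ)‖ ^ 2)
      (2 * x t i * a (x (t - τ)) i - ‖x t‖ ^ 2 - ‖a‖ ^ 2 * ‖x (t - τ)‖ ^ 2) t := fun t ht => by
    have := (((hi t ht).pow 2).sub (hJ t)).sub ((hJ' t).const_mul (‖a‖ ^ 2))
    simp only [Nat.cast_ofNat, Nat.add_one_sub_one, pow_one] at this
    exact this
  have hanti : AntitoneOn (fun t => x t i ^ 2 - (∫ s in (0 : ℝ)..t, ‖x s‖ ^ 2)
      - ‖a‖ ^ 2 * ∫ s in (0 : ℝ)..t, ‖x (s - τ)‖ ^ 2) (Set.Ici 0) := by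
    apply antitoneOn_of_deriv_nonpos (convex_Ici 0)
    · exact (((hxi.pow 2).sub hJc).sub (continuous_const.mul hJc')).continuousOn
    · intro s hs
      rw [interior_Ici] at hs
      exact (hW s hs).differentiableAt.differentiableWithinAt
    · intro s hs
      rw [interior_Ici] at hs
      rw [(hW s hs).deriv]
      have h1 : |x s i| ≤ ‖x s‖ := norm_le_pi_norm (x s) i
      have h2 : |a (x (s - τ)) i| ≤ ‖a‖ * ‖x (s - τ)‖ :=
        (norm_le_pi_norm (a (x (s - τ))) i).trans (a.le_opNorm _)
      have h3 := pow_le_pow_left₀ (abs_nonneg _) h1 2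
      have h4 := pow_le_pow_left₀ (abs_nonneg _) h2 2
      rw [sq_abs] at h3 h4
      nlinarith [two_mul_le_add_sq (x s i) (a (x (s - τ)) i)]
  have := hanti (Set.mem_Ici.2 le_rfl) (Set.mem_Ici.2 ht) ht
  simp only [intervalIntegral.integral_same, mul_zero, sub_zero] at this
  linarith

/-- If the squared norm of a solution has bounded integrals, then the solution tends to zero. -/
theorem delay_tendsto_zero {ι : Type*} [Fintype ι] (a : (ι → ℝ) →L[ℝ] (ι → ℝ)) {τ : ℝ}
    {x : ℝ → ι → ℝ} (hx : Continuous x)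
    (hderiv : ∀ t, 0 < t → HasDerivAt x (a (x (t - τ))) t) {C D : ℝ}
    (hC : ∀ T, 0 ≤ T → ∫ s in (0 : ℝ)..T, ‖x s‖ ^ 2 ≤ C)
    (hD : ∀ T, 0 ≤ T → ∫ s in (0 : ℝ)..T, ‖x (s - τ)‖ ^ 2 ≤ D) :
    Filter.Tendsto x Filter.atTop (nhds 0) := by
  have key : ∀ (f : ℝ → ℝ) (M : ℝ), Continuous f → (∀ s, 0 ≤ f s) →
      (∀ T, 0 ≤ T → ∫ s in (0 : ℝ)..T, f s ≤ M) →
      MeasureTheory.IntegrableOn f (Set.Ioi 0) := by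
    intro f M hf hf0 hM
    refine MeasureTheory.integrableOn_Ioi_of_intervalIntegral_norm_bounded M 0
      (l := Filter.atTop) (b := id) (fun T => ?_) Filter.tendsto_id ?_
    · exact (hf.integrableOn_Icc).mono_set Set.Ioc_subset_Icc_self
    · filter_upwards [Filter.eventually_ge_atTop 0] with T hT
      simpa only [Real.norm_eq_abs, abs_of_nonneg (hf0 _), id] using hM T hT
  have hN := key (fun s => ‖x s‖ ^ 2) C (by fun_prop) (fun _ => by positivity) hC
  have hM := key (fun s => ‖x (s - τ)‖ ^ 2) D (by fun_prop) (fun _ => by positivity) hD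
  rw [tendsto_pi_nhds]
  intro i
  have habs : ∀ s, |x s i| ≤ ‖x s‖ := fun s => norm_le_pi_norm (x s) i
  -- `x_i²` and its derivative are both integrable on the half-line, which forces the limit zero.
  have hsq : Filter.Tendsto (fun t => x t i ^ 2) Filter.atTop (nhds 0) := by
    refine MeasureTheory.tendsto_zero_of_hasDerivAt_of_integrableOn_Ioi (a := 0)
      (f' := fun t => 2 * x t i * a (x (t - τ)) i) (fun t ht => ?_) ?_ ?_
    · have := (hasDerivAt_pi.1 (hderiv t ht) i).pow 2
      simp only [Nat.cast_ofNat, Nat.add_one_sub_one, pow_one] at this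
      exact this
    · refine (hN.add (hM.const_mul (‖a‖ ^ 2))).mono' ?_ ?_
      · exact Continuous.aestronglyMeasurable (by fun_prop)
      · refine Filter.Eventually.of_forall fun s => ?_
        have h2 : |a (x (s - τ)) i| ≤ ‖a‖ * ‖x (s - τ)‖ :=
          (norm_le_pi_norm (a (x (s - τ))) i).trans (a.le_opNorm _)
        have h3 := mul_le_mul (habs s) h2 (abs_nonneg _) (norm_nonneg _)
        simp only [Real.norm_eq_abs, abs_mul, abs_two, Pi.add_apply]
        nlinarith [two_mul_le_add_sq ‖x s‖ (‖a‖ * ‖x (s - τ)‖)]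
    · refine hN.mono' ?_ ?_
      · exact Continuous.aestronglyMeasurable (by fun_prop)
      · refine Filter.Eventually.of_forall fun s => ?_
        have h3 := pow_le_pow_left₀ (abs_nonneg _) (habs s) 2
        simpa using h3
  have := hsq.sqrt
  simp only [Real.sqrt_sq_eq_abs, Real.sqrt_zero] at this
  simpa using (tendsto_zero_iff_abs_tendsto_zero _).2 this

/-- Bounds on the integrals of the squared norm in terms of the initial history. -/
theorem delay_integral_le_of_history {E : Type*} [NormedAddCommGroup E] [NormedSpace ℝ E]
    (a : E →L[ℝ] E) (B : E →L[ℝ] E →L[ℝ] ℝ) (hsymm : ∀ u v, B u v = B v u)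
    (hnonneg : ∀ u, 0 ≤ B u u) {τ c : ℝ} (hτ : 0 ≤ τ) (hc : 0 < c)
    (hB : ∀ u, 2 * B u (a u) + 2 * τ * B (a u) (a u) ≤ -c * ‖u‖ ^ 2) :
    ∃ C, 0 ≤ C ∧ ∀ (x : ℝ → E) (δ : ℝ), Continuous x →
      (∀ t, 0 < t → HasDerivAt x (a (x (t - τ))) t) → (∀ θ ∈ Set.Icc (-τ) 0, ‖x θ‖ ≤ δ) →
      ∀ T, 0 ≤ T → ∫ s in (0 : ℝ)..T, ‖x s‖ ^ 2 ≤ C * δ ^ 2 ∧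
        ∫ s in (0 : ℝ)..T, ‖x (s - τ)‖ ^ 2 ≤ (τ + C) * δ ^ 2 := by
  -- The first summand bounds `B (x τ) (x τ)`; in the second, one `τ` is the weight of the history
  -- integral and the other the length of its interval.
  refine ⟨(‖B‖ * (1 + ‖a‖ * τ) ^ 2 + τ * (τ * (‖B‖ * ‖a‖ ^ 2))) / c, by positivity, ?_⟩
  intro x δ hx hderiv hδ T hT
  have hN : Continuous fun s => ‖x s‖ ^ 2 := by fun_prop
  have hI : ∀ p q, IntervalIntegrable (fun s => ‖x s‖ ^ 2) MeasureTheory.volume p q :=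
    fun p q => hN.intervalIntegrable p q
  have hBq : ∀ u, B u u ≤ ‖B‖ * ‖u‖ ^ 2 := fun u => by
    have := (le_abs_self _).trans (B.le_opNorm₂ u u)
    rwa [mul_assoc, ← sq] at this
  have hfirst : ∫ s in (0 : ℝ)..T, ‖x s‖ ^ 2 ≤
      (‖B‖ * (1 + ‖a‖ * τ) ^ 2 + τ * (τ * (‖B‖ * ‖a‖ ^ 2))) / c * δ ^ 2 := by
    have h1 := delay_integral_norm_sq_le a B hsymm hnonneg hτ hB hx hderiv hT
    have h2 : B (x τ) (x τ) ≤ ‖B‖ * ((1 + ‖a‖ * τ) * δ) ^ 2 := by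
      refine (hBq _).trans ?_
      gcongr
      exact delay_norm_le_of_history a hτ hx hderiv hδ
    have h3 : ∫ s in (-τ)..0, B (a (x s)) (a (x s)) ≤ τ * (‖B‖ * ‖a‖ ^ 2 * δ ^ 2) := by
      calc ∫ s in (-τ)..0, B (a (x s)) (a (x s))
          ≤ ∫ s in (-τ)..0, ‖B‖ * ‖a‖ ^ 2 * δ ^ 2 := by
            refine intervalIntegral.integral_mono_on (by linarith)
              (Continuous.intervalIntegrable (by fun_prop) _ _)
              (continuous_const.intervalIntegrable _ _) fun s hs => (hBq _).trans ?_
            rw [mul_assoc, ← mul_pow]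
            gcongr
            exact (a.le_opNorm _).trans (mul_le_mul_of_nonneg_left (hδ s hs) (norm_nonneg _))
        _ = _ := by
            simp only [intervalIntegral.integral_const, sub_neg_eq_add, zero_add, smul_eq_mul]
    have h4 := mul_le_mul_of_nonneg_left h3 hτ
    rw [div_mul_eq_mul_div, le_div_iff₀ hc]
    nlinarith
  refine ⟨hfirst, ?_⟩
  have hhist : ∫ s in (-τ)..0, ‖x s‖ ^ 2 ≤ τ * δ ^ 2 := by
    calc ∫ s in (-τ)..0, ‖x s‖ ^ 2 ≤ ∫ s in (-τ)..0, δ ^ 2 := by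
          refine intervalIntegral.integral_mono_on (by linarith) (hI _ _)
            (continuous_const.intervalIntegrable _ _) fun s hs => ?_
          exact pow_le_pow_left₀ (norm_nonneg _) (hδ s hs) 2
      _ = _ := by simp
  rw [intervalIntegral.integral_comp_sub_right (fun s => ‖x s‖ ^ 2) τ, zero_sub]
  have h5 : ∫ s in (-τ)..(T - τ), ‖x s‖ ^ 2 ≤ ∫ s in (-τ)..T, ‖x s‖ ^ 2 :=
    intervalIntegral.integral_mono_interval le_rfl (by linarith) (by linarith)
      (Filter.Eventually.of_forall fun s => by positivity) (hI _ _)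
  rw [← intervalIntegral.integral_add_adjacent_intervals (hI (-τ) 0) (hI 0 T)] at h5
  linarith

/-- A quadratic form that is negative off the origin is bounded by `-c ‖u‖²` with `c > 0`. -/
theorem exists_le_neg_mul_norm_sq {E : Type*} [NormedAddCommGroup E] [NormedSpace ℝ E]
    [FiniteDimensional ℝ E] (Q : E → ℝ) (hQ : Continuous Q)
    (hsmul : ∀ (r : ℝ) (u : E), Q (r • u) = r ^ 2 * Q u) (hneg : ∀ u, u ≠ 0 → Q u < 0) :
    ∃ c, 0 < c ∧ ∀ u, Q u ≤ -c * ‖u‖ ^ 2 := by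
  have hQ0 : Q 0 = 0 := by simpa using hsmul 0 0
  have : ProperSpace E := FiniteDimensional.proper ℝ E
  -- The sphere is empty when `E` is trivial, as happens when there are no followers.
  rcases (Metric.sphere (0 : E) 1).eq_empty_or_nonempty with he | hne
  · refine ⟨1, one_pos, fun u => ?_⟩
    have hu : u = 0 := by
      by_contra hu
      have : ‖u‖⁻¹ • u ∈ Metric.sphere (0 : E) 1 := by
        simp [norm_smul, hu]
      simp [he] at this
    simp [hu, hQ0]
  · obtain ⟨w, hw, hmax⟩ := (isCompact_sphere (0 : E) 1).exists_isMaxOn hne hQ.continuousOn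
    have hw0 : w ≠ 0 := by
      rintro rfl
      simp at hw
    refine ⟨-Q w, by linarith [hneg w hw0], fun u => ?_⟩
    by_cases hu : u = 0
    · simp [hu, hQ0]
    · have hmem : ‖u‖⁻¹ • u ∈ Metric.sphere (0 : E) 1 := by
        simp [norm_smul, hu]
      have h1 : Q (‖u‖⁻¹ • u) ≤ Q w := hmax hmem
      have h2 : Q u = ‖u‖ ^ 2 * Q (‖u‖⁻¹ • u) := by
        rw [← hsmul, smul_smul, mul_inv_cancel₀ (norm_ne_zero_iff.2 hu), one_smul]
      rw [h2]
      nlinarith [sq_nonneg ‖u‖]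

/-- A solution extends to a continuous function on the line with the same values on `[-τ, ∞)`. -/
theorem IsDelaySolution.extend {ι : Type*} [Fintype ι] {A : Matrix ι ι ℝ} {τ : ℝ} (hτ : 0 ≤ τ)
    {x : ℝ → ι → ℝ} (hx : IsDelaySolution A τ x) :
    Continuous (fun t => x (max t (-τ))) ∧
      ∀ t, 0 < t → HasDerivAt (fun t => x (max t (-τ))) (A.mulVec (x (max (t - τ) (-τ)))) t := by
  constructor
  · exact hx.continuousOn.comp_continuous (by fun_prop) fun t => Set.mem_Ici.2 (le_max_right _ _)
  · intro t ht
    rw [max_eq_left (by linarith : -τ ≤ t - τ)]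
    have h1 := (hx.hasDeriv t ht.le).hasDerivAt (Ici_mem_nhds ht)
    refine h1.congr_of_eventuallyEq ?_
    filter_upwards [Ioi_mem_nhds ht] with s hs
    rw [max_eq_left (by linarith [Set.mem_Ioi.1 hs] : -τ ≤ s)]

/-- Delay-dependent Lyapunov criterion: if the positive semidefinite form `B` satisfies
`2 B(u, Au) + 2 τ B(Au, Au) < 0` for `u ≠ 0`, then the delay equation of `A` is asymptotically stable. -/
theorem delayAsymptoticallyStable_of_bilinear {ι : Type*} [Fintype ι] (A : Matrix ι ι ℝ)
    (B : (ι → ℝ) →L[ℝ] (ι → ℝ) →L[ℝ] ℝ) (hsymm : ∀ u v, B u v = B v u)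
    (hnonneg : ∀ u, 0 ≤ B u u) {τ : ℝ} (hτ : 0 ≤ τ)
    (hneg : ∀ u, u ≠ 0 →
      2 * B u (A.mulVec u) + 2 * τ * B (A.mulVec u) (A.mulVec u) < 0) :
    DelayAsymptoticallyStable A τ := by
  let a : (ι → ℝ) →L[ℝ] (ι → ℝ) := LinearMap.toContinuousLinearMap A.mulVecLin
  have ha : ∀ u, a u = A.mulVec u := fun _ => rfl
  obtain ⟨c, hc, hB⟩ := exists_le_neg_mul_norm_sq
    (fun u => 2 * B u (a u) + 2 * τ * B (a u) (a u)) (by fun_prop)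
    (fun r u => by simp only [map_smul, smul_apply, smul_eq_mul]; ring)
    (fun u hu => by simpa only [ha] using hneg u hu)
  obtain ⟨C, hC, hbound⟩ := delay_integral_le_of_history a B hsymm hnonneg hτ hc hB
  constructor
  · intro ε hε
    set M := 1 + C + ‖a‖ ^ 2 * (τ + C) with hM
    have hM0 : 0 < M := by positivity
    -- The estimates give `x_i² ≤ M δ²`, and `M δ² < (M + 1)² δ² = ε²`.
    refine ⟨ε / (M + 1), by positivity, fun x hx hδ t ht => ?_⟩
    obtain ⟨hXc, hXd⟩ := hx.extend hτ
    set X := fun t => x (max t (-τ)) with hX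
    have hXx : ∀ t, -τ ≤ t → X t = x t := fun t ht => by simp only [hX, max_eq_left ht]
    set δ := ε / (M + 1) with hδdef
    have hXδ : ∀ θ ∈ Set.Icc (-τ) 0, ‖X θ‖ ≤ δ := fun θ hθ => by
      rw [hXx θ hθ.1]; exact (hδ θ hθ).le
    obtain ⟨h1, h2⟩ := hbound X δ hXc hXd hXδ t ht
    rw [← hXx t (by linarith), pi_norm_lt_iff hε]
    intro i
    have h3 := delay_coord_sq_le a hXc hXd i ht
    have h4 : X 0 i ^ 2 ≤ δ ^ 2 := by
      rw [← sq_abs]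
      exact pow_le_pow_left₀ (abs_nonneg _)
        ((norm_le_pi_norm (X 0) i).trans (hXδ 0 ⟨by linarith, le_rfl⟩)) 2
    have h5 : X t i ^ 2 ≤ M * δ ^ 2 := by
      have := mul_le_mul_of_nonneg_left h2 (sq_nonneg ‖a‖)
      rw [hM]
      linarith
    have h6 : M * δ ^ 2 < ε ^ 2 := by
      have : ε = (M + 1) * δ := by rw [hδdef]; field_simp
      have hδ0 : 0 < δ ^ 2 := by positivity
      rw [this]
      nlinarith
    exact abs_lt_of_sq_lt_sq (h5.trans_lt h6) hε.le
  · intro x hx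
    obtain ⟨hXc, hXd⟩ := hx.extend hτ
    set X := fun t => x (max t (-τ)) with hX
    obtain ⟨δ, hδ⟩ := (isCompact_Icc (a := -τ) (b := 0)).exists_bound_of_continuousOn
      hXc.continuousOn
    have hlim := delay_tendsto_zero a hXc hXd
      (fun T hT => (hbound X δ hXc hXd hδ T hT).1) (fun T hT => (hbound X δ hXc hXd hδ T hT).2)
    refine hlim.congr' ?_
    filter_upwards [Filter.eventually_ge_atTop (-τ)] with t ht
    simp only [hX, max_eq_left ht]

/-! ### A Lyapunov form for the formation dynamics -/

open Matrix in
/-- The matrix `I ⊗ B₁ + L ⊗ B₂` with unit gains acts on positions `p` and velocities `q` by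
`(p, q) ↦ (q, -L (p + q))`. -/
theorem kronecker_formation_mulVec {F : Type*} [Fintype F] [DecidableEq F] (L : Matrix F F ℝ)
    (u : F × Fin 2 → ℝ) (i : F) :
    (((1 : Matrix F F ℝ) ⊗ₖ !![0, 1; 0, 0] + L ⊗ₖ !![0, 0; -1, -1]) *ᵥ u) (i, 0) = u (i, 1) ∧
    (((1 : Matrix F F ℝ) ⊗ₖ !![0, 1; 0, 0] + L ⊗ₖ !![0, 0; -1, -1]) *ᵥ u) (i, 1) =
      -(L *ᵥ fun j => u (j, 0) + u (j, 1)) i := by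
  constructor
  · simp [mulVec, dotProduct, Fintype.sum_prod_type, Matrix.one_apply]
  · simp [mulVec, dotProduct, Fintype.sum_prod_type, Matrix.one_apply, mul_add]
    rw [← Finset.sum_neg_distrib]
    exact Finset.sum_congr rfl fun j _ => by ring

open Matrix in
/-- The polarized form of `‖p + b w‖_L² + ‖p‖_L² + 2 w · (1 + (τ² - τ) L) w`. -/
def energyForm {F : Type*} [Fintype F] (L : Matrix F F ℝ) (b τ : ℝ) (p w p' w' : F → ℝ) : ℝ :=
  (L *ᵥ (p + b • w)) ⬝ᵥ (p' + b • w') + (L *ᵥ p) ⬝ᵥ p'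
    + 2 * (w ⬝ᵥ w' + (τ ^ 2 - τ) * ((L *ᵥ w) ⬝ᵥ w'))

open Matrix in
theorem Matrix.IsSymm.mulVec_dotProduct_comm {F : Type*} [Fintype F] {L : Matrix F F ℝ}
    (hL : L.IsSymm) (p q : F → ℝ) : (L *ᵥ p) ⬝ᵥ q = (L *ᵥ q) ⬝ᵥ p := by
  rw [dotProduct_comm, dotProduct_mulVec, ← mulVec_transpose, hL.eq]

-- With `b = 1 - 2τ`, adding `b L r` to `L (p + τ q + τ r)` leaves only terms in `y`. The weight `1
-- + (τ² - τ) L` in the energy then cancels all cross terms between `r` and `y`.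
open Matrix in
theorem energyForm_dissipation {F : Type*} [Fintype F] {L : Matrix F F ℝ} (hL : L.IsSymm)
    (τ : ℝ) (p q y r : F → ℝ) (hy : y = -(L *ᵥ (p + q))) (hr : r = q + τ • y) :
    energyForm L (1 - 2 * τ) τ (p + τ • q + τ • r) r r y =
      -(1 - 2 * τ) * (y ⬝ᵥ y - τ * ((L *ᵥ y) ⬝ᵥ y) + τ ^ 2 * ((L *ᵥ y) ⬝ᵥ y)
        + (L *ᵥ r) ⬝ᵥ r) := by
  have hp : L *ᵥ p = -y - L *ᵥ q := by rw [hy, mulVec_add]; module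
  have hq : q = r - τ • y := by rw [hr]; module
  have hm : L *ᵥ (p + τ • q + τ • r) =
      -((1 - 2 * τ) • (L *ᵥ r)) - y - (τ ^ 2 - τ) • (L *ᵥ y) := by
    rw [mulVec_add, mulVec_add, hp, hq]
    simp only [mulVec_smul, mulVec_sub]
    module
  rw [energyForm, mulVec_add, hm]
  simp only [mulVec_smul, add_dotProduct, sub_dotProduct, neg_dotProduct, smul_dotProduct,
    dotProduct_add, dotProduct_smul, smul_eq_mul]
  rw [IsSymm.mulVec_dotProduct_comm hL y r, dotProduct_comm y r]
  ring

open Matrix in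
/-- Asymptotic stability of the unit-gain formation dynamics for a symmetric positive definite
matrix `L` with `τ L < 1` and `τ < 1/2`. -/
theorem kronecker_formation_stable {F : Type*} [Fintype F] [DecidableEq F] {L : Matrix F F ℝ}
    (hL : L.IsSymm) (hpos : ∀ u, u ≠ 0 → 0 < (L *ᵥ u) ⬝ᵥ u) {τ : ℝ} (hτ : 0 ≤ τ)
    (hτ2 : τ < 1 / 2) (hbound : ∀ u, u ≠ 0 → τ * ((L *ᵥ u) ⬝ᵥ u) < u ⬝ᵥ u) :
    DelayAsymptoticallyStable
      ((1 : Matrix F F ℝ) ⊗ₖ !![0, 1; 0, 0] + L ⊗ₖ !![0, 0; -1, -1]) τ := by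
  have hpos' : ∀ u, 0 ≤ (L *ᵥ u) ⬝ᵥ u := fun u => by
    by_cases hu : u = 0
    · simp [hu]
    · exact (hpos u hu).le
  have hD : ∀ u, u ≠ 0 →
      0 < u ⬝ᵥ u - τ * ((L *ᵥ u) ⬝ᵥ u) + τ ^ 2 * ((L *ᵥ u) ⬝ᵥ u) := fun u hu => by
    have h1 := hbound u hu
    have h2 := mul_nonneg (sq_nonneg τ) (hpos' u)
    linarith
  have hD' : ∀ u, 0 ≤ u ⬝ᵥ u - τ * ((L *ᵥ u) ⬝ᵥ u) + τ ^ 2 * ((L *ᵥ u) ⬝ᵥ u) := fun u => by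
    by_cases hu : u = 0
    · simp [hu]
    · exact (hD u hu).le
  let pos : (F × Fin 2 → ℝ) → F → ℝ := fun u i => u (i, 0)
  let vel : (F × Fin 2 → ℝ) → F → ℝ := fun u i => u (i, 1)
  let form : (F × Fin 2 → ℝ) → (F × Fin 2 → ℝ) → ℝ := fun u v =>
    energyForm L (1 - 2 * τ) τ (pos u + τ • vel u) (vel u) (pos v + τ • vel v) (vel v)
  have hpa : ∀ u v, pos (u + v) = pos u + pos v := fun _ _ => rfl
  have hva : ∀ u v, vel (u + v) = vel u + vel v := fun _ _ => rfl
  have hps : ∀ (s : ℝ) u, pos (s • u) = s • pos u := fun _ _ => rfl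
  have hvs : ∀ (s : ℝ) u, vel (s • u) = s • vel u := fun _ _ => rfl
  have hsymm : ∀ u v, form u v = form v u := fun u v => by
    simp only [form, energyForm]
    rw [IsSymm.mulVec_dotProduct_comm hL (pos u + τ • vel u + _),
      IsSymm.mulVec_dotProduct_comm hL (pos u + τ • vel u),
      IsSymm.mulVec_dotProduct_comm hL (vel u), dotProduct_comm (vel u)]
  have hadd : ∀ u v w, form (u + v) w = form u w + form v w := fun u v w => by
    simp only [form, energyForm, hpa, hva, mulVec_add, mulVec_smul, add_dotProduct,
      smul_dotProduct, smul_eq_mul]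
    ring
  have hsmul : ∀ (s : ℝ) u w, form (s • u) w = s * form u w := fun s u w => by
    simp only [form, energyForm, hps, hvs, mulVec_add, mulVec_smul, add_dotProduct,
      smul_dotProduct, smul_eq_mul]
    ring
  let B : (F × Fin 2 → ℝ) →L[ℝ] (F × Fin 2 → ℝ) →L[ℝ] ℝ :=
    (LinearMap.mk₂ ℝ form hadd hsmul
      (fun u v w => by rw [hsymm, hadd, hsymm v, hsymm w])
      (fun s u w => by rw [hsymm, hsmul, hsymm w, smul_eq_mul])).toContinuousBilinearMap
  have hB : ∀ u v, B u v = form u v := fun _ _ => rfl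
  refine delayAsymptoticallyStable_of_bilinear _ B hsymm (fun u => ?_) hτ (fun u hu => ?_)
  · rw [hB]
    simp only [form, energyForm]
    have h1 := hpos' (pos u + τ • vel u + (1 - 2 * τ) • vel u)
    have h2 := hpos' (pos u + τ • vel u)
    have h3 := hD' (vel u)
    linarith
  · set v := ((1 : Matrix F F ℝ) ⊗ₖ !![0, 1; 0, 0] + L ⊗ₖ !![0, 0; -1, -1]) *ᵥ u with hv
    have hv0 : pos v = vel u := funext fun i => (kronecker_formation_mulVec L u i).1
    have hv1 : vel v = -(L *ᵥ (pos u + vel u)) :=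
      funext fun i => (kronecker_formation_mulVec L u i).2
    -- Both terms of the criterion merge into one pairing of `u + τ v` with `v`, the quantity
    -- computed by `energyForm_dissipation`.
    have hcomb : 2 * B u v + 2 * τ * B v v = 2 * form (u + τ • v) v := by
      rw [hB, hB, hadd, hsmul]; ring
    have hdis := energyForm_dissipation hL τ (pos u) (vel u) (vel v) (vel u + τ • vel v) hv1 rfl
    have hform : form (u + τ • v) v = energyForm L (1 - 2 * τ) τ
        (pos u + τ • vel u + τ • (vel u + τ • vel v)) (vel u + τ • vel v)
        (vel u + τ • vel v) (vel v) := by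
      simp only [form, hpa, hva, hps, hvs, hv0]
    rw [hcomb, hform, hdis]
    have hb : 0 < 1 - 2 * τ := by linarith
    suffices h : 0 < vel v ⬝ᵥ vel v - τ * ((L *ᵥ vel v) ⬝ᵥ vel v)
        + τ ^ 2 * ((L *ᵥ vel v) ⬝ᵥ vel v)
        + (L *ᵥ (vel u + τ • vel v)) ⬝ᵥ (vel u + τ • vel v) by
      have := mul_pos hb h
      linarith
    -- If the acceleration vanishes, the velocity cannot: otherwise `L` would annihilate a nonzero
    -- position vector.
    by_cases hw : vel v = 0
    · have hq : vel u ≠ 0 := by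
        intro hq
        have hp : pos u ≠ 0 := by
          intro hp
          apply hu
          ext ⟨i, j⟩
          fin_cases j
          · exact congrFun hp i
          · exact congrFun hq i
        have h1 := hpos _ hp
        rw [hw, hq, add_zero, eq_comm, neg_eq_zero] at hv1
        simp [hv1] at h1
      rw [hw]
      simpa using hpos _ hq
    · exact add_pos_of_pos_of_nonneg (hD _ hw) (hpos' _)

/-! ### Spectral bounds for grounded Laplacians -/

open Matrix in
/-- The quadratic form of the grounded Laplacian is that of the Laplacian on the extension by
zero. -/
theorem groundedLaplacian_mulVec_dotProduct {V : Type*} [Fintype V] [DecidableEq V]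
    (G : SimpleGraph V) [DecidableRel G.Adj] (R : Finset V) (u : {v : V // v ∉ R} → ℝ) :
    (groundedLaplacian G R *ᵥ u) ⬝ᵥ u =
      (∑ i : V, ∑ j : V, if G.Adj i j then
        (Function.extend Subtype.val u 0 i - Function.extend Subtype.val u 0 j) ^ 2 else 0) / 2 := by
  rw [← SimpleGraph.lapMatrix_toLinearMap₂', toLinearMap₂'_apply', dotProduct_comm]
  set w : V → ℝ := Function.extend Subtype.val u 0 with hw
  have hval : ∀ i : {v : V // v ∉ R}, w i = u i := fun i => Subtype.val_injective.extend_apply _ _ _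
  have hout : ∀ i, i ∉ Set.range (Subtype.val : {v : V // v ∉ R} → V) → w i = 0 := fun i hi => by
    rw [hw, Function.extend_apply' _ _ _ (by simpa using hi)]; rfl
  simp only [dotProduct, mulVec]
  refine Fintype.sum_of_injective Subtype.val Subtype.val_injective _ _
    (fun i hi => by rw [hout i hi, zero_mul]) fun i => ?_
  rw [hval]
  congr 1
  refine Fintype.sum_of_injective Subtype.val Subtype.val_injective _ _
    (fun j hj => by rw [hout j hj, mul_zero]) fun j => ?_
  rw [hval]
  rfl

-- By `(a - b)² ≤ 2a² + 2b²` on each edge, every vertex is charged at most twice its degree.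
open Matrix in
theorem groundedLaplacian_dotProduct_le {V : Type*} [Fintype V] [DecidableEq V]
    (G : SimpleGraph V) [DecidableRel G.Adj] (R : Finset V) {d : ℕ} (hd : ∀ v, G.degree v ≤ d)
    (u : {v : V // v ∉ R} → ℝ) :
    (groundedLaplacian G R *ᵥ u) ⬝ᵥ u ≤ 2 * d * (u ⬝ᵥ u) := by
  rw [groundedLaplacian_mulVec_dotProduct]
  set w : V → ℝ := Function.extend Subtype.val u 0 with hw
  have hval : ∀ i : {v : V // v ∉ R}, w i = u i := fun i => Subtype.val_injective.extend_apply _ _ _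
  have hnorm : u ⬝ᵥ u = ∑ i, w i ^ 2 := by
    simp only [dotProduct]
    refine Fintype.sum_of_injective Subtype.val Subtype.val_injective _ _ (fun i hi => ?_)
      fun i => ?_
    · rw [hw, Function.extend_apply' _ _ _ (by simpa using hi)]; simp
    · rw [hval, sq]
  have hrow : ∑ i, ∑ j, (if G.Adj i j then w i ^ 2 else 0) ≤ d * ∑ i, w i ^ 2 := by
    rw [Finset.mul_sum]
    refine Finset.sum_le_sum fun i _ => ?_
    have : ∑ j, (if G.Adj i j then w i ^ 2 else 0) = G.degree i * w i ^ 2 := by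
      rw [← Finset.sum_filter, Finset.sum_const, nsmul_eq_mul,
        ← SimpleGraph.card_neighborFinset_eq_degree, SimpleGraph.neighborFinset_eq_filter]
    rw [this]
    gcongr
    exact hd i
  have hcol : ∑ i, ∑ j, (if G.Adj i j then w j ^ 2 else 0) =
      ∑ i, ∑ j, (if G.Adj i j then w i ^ 2 else 0) := by
    rw [Finset.sum_comm]
    simp only [G.adj_comm]
  have hpt : ∑ i, ∑ j, (if G.Adj i j then (w i - w j) ^ 2 else 0) ≤
      2 * ∑ i, ∑ j, (if G.Adj i j then w i ^ 2 else 0)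
        + 2 * ∑ i, ∑ j, (if G.Adj i j then w j ^ 2 else 0) := by
    simp only [Finset.mul_sum, ← Finset.sum_add_distrib]
    refine Finset.sum_le_sum fun i _ => Finset.sum_le_sum fun j _ => ?_
    split_ifs
    · nlinarith [sq_nonneg (w i + w j)]
    · simp
  rw [hnorm]
  rw [hcol] at hpt
  linarith

-- Zero energy makes the extension by zero constant on a connected graph, and it vanishes at a
-- reference vertex.
open Matrix in
theorem groundedLaplacian_dotProduct_pos {V : Type*} [Fintype V] [DecidableEq V]
    (G : SimpleGraph V) [DecidableRel G.Adj] (hG : G.Preconnected) (R : Finset V)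
    (hR : R.Nonempty) (u : {v : V // v ∉ R} → ℝ) (hu : u ≠ 0) :
    0 < (groundedLaplacian G R *ᵥ u) ⬝ᵥ u := by
  rw [groundedLaplacian_mulVec_dotProduct]
  set w : V → ℝ := Function.extend Subtype.val u 0 with hw
  refine lt_of_le_of_ne (by positivity) fun h => hu ?_
  rw [← SimpleGraph.lapMatrix_toLinearMap₂', eq_comm,
    SimpleGraph.lapMatrix_toLinearMap₂'_apply'_eq_zero_iff_forall_reachable] at h
  obtain ⟨r, hr⟩ := hR
  ext i
  have hwr : w r = 0 := by
    rw [hw, Function.extend_apply' _ _ _ (by simpa using hr)]; rfl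
  rw [← Subtype.val_injective.extend_apply u 0 i, ← hw, h i r (hG i r), hwr]
  rfl

/-! ### Degree and connectivity of the platoon -/

theorem platoon_degree_le (n k : ℕ) (i : Fin n) : (platoon n k).degree i ≤ 2 * k := by
  rw [← SimpleGraph.card_neighborFinset_eq_degree]
  have hinj : Function.Injective fun j : Fin n => ((j : ℕ) : ℤ) := fun a b h => by
    simpa [Fin.ext_iff] using h
  rw [← Finset.card_image_of_injective _ hinj]
  calc _ ≤ ((Finset.Icc (((i : ℕ) : ℤ) - k) ((i : ℕ) + k)).erase ((i : ℕ) : ℤ)).card := by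
        refine Finset.card_le_card fun m hm => ?_
        simp only [Finset.mem_image, SimpleGraph.mem_neighborFinset] at hm
        obtain ⟨j, ⟨hne, hj⟩, rfl⟩ := hm
        rw [abs_le] at hj
        simp only [Finset.mem_erase, Finset.mem_Icc]
        refine ⟨fun h => hne (hinj h).symm, ?_, ?_⟩ <;> omega
    _ = 2 * k := by
        rw [Finset.card_erase_of_mem (by simp), Int.card_Icc]
        omega

theorem platoon_preconnected (n k : ℕ) (hk : 1 ≤ k) : (platoon n k).Preconnected := by
  have h0 : ∀ (m : ℕ) (hm : m < n), (platoon n k).Reachable ⟨0, by omega⟩ ⟨m, hm⟩ := by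
    intro m
    induction m with
    | zero => exact fun hm => SimpleGraph.Reachable.refl _
    | succ m ih =>
      intro hm
      refine (ih (by omega)).trans (SimpleGraph.Adj.reachable ⟨by simp, ?_⟩)
      simp only [Nat.cast_add, Nat.cast_one]
      rw [abs_le]
      omega
  exact fun i j => (h0 i i.2).symm.trans (h0 j j.2)

theorem mainTheorem4 (n k : ℕ) (hk : 1 ≤ k) (R : Finset (Fin n)) (hR : R.Nonempty)
    (τmax : ℝ) (hτmax : τmax < 1 / (4 * (k : ℝ))) :
    ∀ τ ∈ Set.Icc (0 : ℝ) τmax,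
      DelayAsymptoticallyStable (formationMatrix (platoon n k) R 1 1) τ := by
  intro τ hτ
  have hk' : (1 : ℝ) ≤ k := by exact_mod_cast hk
  have hτk : τ * (4 * k) < 1 := (lt_div_iff₀ (by positivity)).1 (hτ.2.trans_lt hτmax)
  refine kronecker_formation_stable (L := groundedLaplacian (platoon n k) R)
    (((platoon n k).isSymm_lapMatrix ℝ).submatrix _)
    (groundedLaplacian_dotProduct_pos _ (platoon_preconnected n k hk) R hR) hτ.1
    -- As `k ≥ 1`, the delay satisfies `τ < 1/4`, so `τ < 1/2` costs nothing.
    (by nlinarith [hτ.1]) fun u hu => ?_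
  have h1 := groundedLaplacian_dotProduct_le (platoon n k) R (platoon_degree_le n k) u
  have h2 : 0 < u ⬝ᵥ u :=
    lt_of_le_of_ne (Finset.sum_nonneg fun i _ => mul_self_nonneg (u i))
      fun h => hu (dotProduct_self_eq_zero.1 h.symm)
  have h3 := mul_le_mul_of_nonneg_left h1 hτ.1
  have h4 := mul_lt_mul_of_pos_right hτk h2
  push_cast at h3
  linarith
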